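/- Let $\mathcal Z$ be a noetherian abelian category of homological dimension (at most) $2$, i.e. $\mathrm{Ext}^i_{\mathcal Z}(E,F)=0$ for all $E,F\in\mathcal Z$ and $i\notin[0,2]$. Let $T$ be a tilting object of $\mathcal Z$, with endomorphism algebra $A=\mathrm{Hom}_{\mathcal Z}(T,T)$: that is, $\mathrm{Ext}^i_{\mathcal Z}(T,T)=0$ for $i\neq 0$, and the derived functor $R\mathrm{Hom}(T,-)$ exists and induces an equivalence of triangulated categories $\Phi:D^b(\mathcal Z)\to D^b(\mathcal A)$, where $\mathcal A=\mathrm{mod}\,A^{op}$ is the category of finitely generated right $A$-modules and $A$ is right noetherian (so that $\mathcal A$ is an abelian subcategory of the category of all right $A$-modules). Let $\Psi$ be a quasi-inverse of $\Phi$ and, for $M\in\mathcal A$, put $\Psi^j(M)=H^j(\Psi M)\in\mathcal Z$. Define the full subcategories of $\mathcal A$ \[ \mathcal C_i=\{M\in\mathcal A:\Psi^i(M)=0\},\qquad \mathcal Y_i=\{M\in\mathcal A:\Psi^j(M)=0\ \text{for all } j\neq i\}, \] and, for a full subcategory $\mathcal V$ of $\mathcal A$, put $\mathcal V^\circ=\{E\in\mathcal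 A:\mathrm{Hom}_{\mathcal A}(V,E)=0\ \text{for all } V\in\mathcal V\}$. Then $(\mathcal C_0,\mathcal C_0^\circ)$ is a torsion pair in $\mathcal A$, and its torsion-free class is \[ \mathcal C_0^\circ=\mathcal Y_{-1}^\circ\cap\mathcal Y_{-2}^\circ . \] No further condition is imposed; in particular this covers the case in which the spectral sequences $\Psi^p(\Phi^qE)\Rightarrow E$ (for $E\in\mathcal Z$) and $\Phi^p(\Psi^qM)\Rightarrow M$ (for $M\in\mathcal A$) are required to exist. -/

import Mathlib

open CategoryTheory Limits

universe w₁ w₂ v u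

noncomputable section

namespace TiltingHearts

section Abelian

variable {C : Type u} [Category.{v} C] [Abelian C]

/-- `(P, Q)` is a torsion pair in the abelian category `C`: `P` and `Q` are strictly full
subcategories, there are no nonzero morphisms from `P` to `Q`, and every object is an extension
of an object of `Q` by an object of `P`. -/
structure IsTorsionPair (P Q : ObjectProperty C) : Prop where
  torsion_isClosedUnderIso : P.IsClosedUnderIsomorphisms
  torsionFree_isClosedUnderIso : Q.IsClosedUnderIsomorphisms
  hom_eq_zero : ∀ ⦃X Y : C⦄ (f : X ⟶ Y), P X → Q Y → f = 0
  exists_shortExact : ∀ E : C, ∃ (X Y : C) (i : X ⟶ E) (p : E ⟶ Y) (h : i ≫ p = 0),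
    P X ∧ Q Y ∧ (ShortComplex.mk i p h).ShortExact

/-- The inclusion of an abelian category in its bounded derived category, as complexes
concentrated in degree `0`. -/
def toBounded (C : Type u) [Category.{v} C] [Abelian C] [HasDerivedCategory.{w₁} C] :
    C ⥤ DerivedCategory.Bounded C :=
  DerivedCategory.TStructure.t.bounded.lift (DerivedCategory.singleFunctor C 0)
    (fun _ => ⟨⟨0, inferInstance⟩, ⟨0, inferInstance⟩⟩)

/-- The degree-`i` cohomology functor on the bounded derived category. -/
abbrev boundedCohomology (C : Type u) [Category.{v} C] [Abelian C] [HasDerivedCategory.{w₁} C]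
    (i : ℤ) : DerivedCategory.Bounded C ⥤ C :=
  DerivedCategory.Bounded.ι ⋙ DerivedCategory.homologyFunctor C i

/-- The inclusion of the bounded derived category in the bounded below derived category. -/
abbrev boundedToPlus (C : Type u) [Category.{v} C] [Abelian C] [HasDerivedCategory.{w₁} C] :
    DerivedCategory.Bounded C ⥤ DerivedCategory.Plus C :=
  ObjectProperty.ιOfLE inf_le_left

variable [HasDerivedCategory.{w₁} C]

/-- `Ext^i(E, F)` for `i : ℤ`, as the group of morphisms `E ⟶ F[i]` in the derived category. -/
abbrev ExtGroup (E F : C) (i : ℤ) : Type w₁ :=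
  (DerivedCategory.singleFunctor C 0).obj E ⟶
    (shiftFunctor (DerivedCategory C) i).obj ((DerivedCategory.singleFunctor C 0).obj F)

/-- `C` has homological dimension (at most) `n`: `Ext^i(E, F) = 0` for all objects `E, F` and
all `i ∉ [0, n]`. -/
def HasHomologicalDimension (C : Type u) [Category.{v} C] [Abelian C]
    [HasDerivedCategory.{w₁} C] (n : ℕ) : Prop :=
  ∀ (E F : C) (i : ℤ), i ∉ Set.Icc (0 : ℤ) n → Subsingleton (ExtGroup E F i)

end Abelian

variable {Z : Type u} [Category.{v} Z] [Abelian Z]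

/-- The category `mod A^op` of finitely generated right modules over `A = End(T)`. -/
abbrev RightMod (T : Z) : Type (v + 1) := FGModuleCat.{v} (End T)ᵐᵒᵖ

instance (R : Type v) [Ring R] [IsNoetherianRing R] :
    (forget₂ (FGModuleCat.{v} R) (ModuleCat.{v} R)).Additive where
  map_add := rfl

section RHom

variable [HasDerivedCategory.{v} Z] (T : Z) [HasDerivedCategory.{w₂} (ModuleCat.{v} (End T)ᵐᵒᵖ)]

/-- The functor which sends a bounded below complex `K` in `Z` to the complex `Hom(T, K)` of right
`End(T)`-modules, seen as an object of the derived category. -/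
abbrev homComplex : HomotopyCategory.Plus Z ⥤ DerivedCategory.Plus (ModuleCat.{v} (End T)ᵐᵒᵖ) :=
  (preadditiveCoyonedaObj T).mapHomotopyCategoryPlus ⋙ DerivedCategory.Plus.Qh

/-- The condition that `Hom(T, -)` has a total right derived functor on the bounded below derived
category. (It is automatic when `Z` has enough injectives, but categories such as
that of coherent sheaves do not have enough injectives.) -/
abbrev HasRHom : Prop :=
  (homComplex.{w₂} T).HasRightDerivedFunctor (HomotopyCategory.Plus.quasiIso Z)

/-- The derived functor `RHom(T, -)` from the bounded below derived category of `Z` to that of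
right `End(T)`-modules. -/
def RHom [HasRHom.{w₂} T] :
    DerivedCategory.Plus Z ⥤ DerivedCategory.Plus (ModuleCat.{v} (End T)ᵐᵒᵖ) :=
  (homComplex.{w₂} T).totalRightDerived DerivedCategory.Plus.Qh
    (HomotopyCategory.Plus.quasiIso Z)

end RHom

variable [HasDerivedCategory.{v} Z] (T : Z) [IsNoetherianRing (End T)ᵐᵒᵖ]
  [HasDerivedCategory.{w₁} (RightMod T)] [HasDerivedCategory.{w₂} (ModuleCat.{v} (End T)ᵐᵒᵖ)]

/-- `T` is a tilting object of `Z`: one has `Ext^i(T, T) = 0` for `i ≠ 0`, the derived functor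
`RHom(T, -)` exists, and it induces an equivalence of triangulated categories
`Φ : D^b(Z) ≌ D^b(mod A^op)`, where `A = End(T)`. The structure records the equivalence `Φ`
and the identification of `Φ` with the restriction of `RHom(T, -)`. -/
structure Tilting where
  ext_self (i : ℤ) (hi : i ≠ 0) : Subsingleton (ExtGroup T T i)
  hasRHom : HasRHom.{w₂} T
  Φ : DerivedCategory.Bounded Z ≌ DerivedCategory.Bounded (RightMod T)
  commShift : Φ.functor.CommShift ℤ
  isTriangulated : Φ.functor.IsTriangulated
  isoRHom : Φ.functor ⋙ DerivedCategory.Bounded.ι ⋙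
      (forget₂ (RightMod T) (ModuleCat.{v} (End T)ᵐᵒᵖ)).mapDerivedCategory ≅
    boundedToPlus Z ⋙ RHom.{w₂} T ⋙ DerivedCategory.Plus.ι

namespace Tilting

variable {T} (t : Tilting.{w₁, w₂} T)

/-- For a finitely generated right `End(T)`-module `M`, the object `Ψ^j(M)` of `Z` is the
degree-`j` cohomology of `Ψ(M)`, where `Ψ` is the quasi-inverse of `Φ`. -/
def cohomologyΨ (j : ℤ) : RightMod T ⥤ Z :=
  toBounded (RightMod T) ⋙ t.Φ.inverse ⋙ boundedCohomology Z j

/-- The full subcategory `Y_i` of modules `M` such that `Ψ^j(M) = 0` for all `j ≠ i`. -/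
def Y (i : ℤ) : ObjectProperty (RightMod T) :=
  fun M => ∀ j : ℤ, j ≠ i → IsZero ((t.cohomologyΨ j).obj M)

/-- The full subcategory `C_i` of modules `M` such that `Ψ^i(M) = 0`. -/
def C (i : ℤ) : ObjectProperty (RightMod T) :=
  fun M => IsZero ((t.cohomologyΨ i).obj M)

end Tilting

end TiltingHearts

end

/-! Write `E[-j]` for `E` placed in degree `j`. The vanishing of `Ext^{n-j}(T, E)` outside `0 ≤ n -
j ≤ 2` puts `Φ(E[-j])` in degrees `[j, j+2]`; testing against such objects puts `Ψ(M)` in degrees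
`[-2, 0]`. Hence `Ψ^0(M) = 0` exactly when `M` has no nonzero map to any `Φ(E)` (`mem_C_zero_iff`),
so `C_0` is closed under quotients and extensions. Modules in `RightMod T` are noetherian objects,
so this makes `C_0` a torsion class (`isTorsionPair_rightOrthogonal`).

Since `Y_{-1}` and `Y_{-2}` lie in `C_0`, one inclusion is immediate. For the other, the torsion
part of an object orthogonal to both is again orthogonal to both, so it is enough that such an `M`
in `C_0` vanishes (`isZero_of_mem_C_zero`). Applying `Φ` to the triangle `Ψ^{-2}(M)[2] ⟶ Ψ(M) ⟶
Ψ^{-1}(M)[1]` shows that its first term becomes a module `N` in `Y_{-2}`. The map `N ⟶ M` is zero,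
so `Ψ^{-2}(M) = 0`; then `M` lies in `Y_{-1}` and its identity is zero.

The delicate input is the vanishing criterion for `H^n(RHom(T, E))` (`isZero_homology_RHom`): `RHom`
is known only through the universal property of a Kan extension, which is tested on functors built
from injective modules. -/

noncomputable section

namespace TiltingHearts

/-! ### Truncation triangles, and maps into an injective object placed in one degree. -/

section SingleInjective

open DerivedCategory Pretriangulated

variable {C : Type u} [Category.{v} C] [Abelian C] [HasDerivedCategory.{w₁} C]

variable {A B D : DerivedCategory C} {f : A ⟶ B} {g : B ⟶ D} {h : D ⟶ A⟦(1 : ℤ)⟧}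

lemma isIso_homology_mor₁ (hT : Triangle.mk f g h ∈ distTriang _) (n : ℤ)
    (_ : D.IsGE (n + 1)) : IsIso ((homologyFunctor C n).map f) := by
  have : Epi ((homologyFunctor C n).map f) :=
    (HomologySequence.epi_homologyMap_mor₁_iff _ hT n).2
      ((isZero_of_isGE D (n + 1) n (by lia)).eq_of_tgt _ _)
  have : Mono ((homologyFunctor C n).map f) :=
    (HomologySequence.mono_homologyMap_mor₁_iff _ hT (n - 1) n).2
      ((isZero_of_isGE D (n + 1) (n - 1) (by lia)).eq_of_src _ _)
  exact isIso_of_mono_of_epi _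

lemma isIso_homology_mor₂ (hT : Triangle.mk f g h ∈ distTriang _) (n : ℤ)
    (_ : A.IsLE (n - 1)) : IsIso ((homologyFunctor C n).map g) := by
  have : Epi ((homologyFunctor C n).map g) :=
    (HomologySequence.epi_homologyMap_mor₂_iff _ hT n (n + 1)).2
      ((isZero_of_isLE A (n - 1) (n + 1) (by lia)).eq_of_tgt _ _)
  have : Mono ((homologyFunctor C n).map g) :=
    (HomologySequence.mono_homologyMap_mor₂_iff _ hT n).2
      ((isZero_of_isLE A (n - 1) n (by lia)).eq_of_src _ _)
  exact isIso_of_mono_of_epi _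

lemma isLE_obj₃ (hT : Triangle.mk f g h ∈ distTriang _) (n : ℤ)
    (_ : A.IsLE (n + 1)) (_ : B.IsLE n) : D.IsLE n := by
  rw [isLE_iff]
  intro i hi
  exact (HomologySequence.exact₃ _ hT i (i + 1)).isZero_of_both_zeros
    ((isZero_of_isLE B n i hi).eq_of_src _ _)
    ((isZero_of_isLE A (n + 1) (i + 1) (by lia)).eq_of_tgt _ _)

lemma isGE_obj₁ (hT : Triangle.mk f g h ∈ distTriang _) (n : ℤ)
    (_ : B.IsGE n) (_ : D.IsGE (n - 1)) : A.IsGE n := by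
  rw [isGE_iff]
  intro i hi
  exact (HomologySequence.exact₁ _ hT (i - 1) i).isZero_of_both_zeros
    ((isZero_of_isGE D (n - 1) (i - 1) (by lia)).eq_of_src _ _)
    ((isZero_of_isGE B n i hi).eq_of_tgt _ _)

/-- A complex with cohomology in degrees `≤ n` maps to its cohomology in degree `n`. -/
lemma exists_hom_single_of_isLE (X : DerivedCategory C) (n : ℤ) [X.IsLE n] :
    ∃ (Y : C) (A : DerivedCategory C) (f : A ⟶ X) (g : X ⟶ (singleFunctor C n).obj Y)
      (h : (singleFunctor C n).obj Y ⟶ A⟦(1 : ℤ)⟧),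
      Triangle.mk f g h ∈ distTriang _ ∧ A.IsLE (n - 1) := by
  obtain ⟨A, B, hA, hB, f, g, h, hT⟩ := TStructure.t.exists_triangle X (n - 1) n (by lia)
  have hA' : A.IsLE (n - 1) := ⟨hA⟩
  have : B.IsGE n := ⟨hB⟩
  have : B.IsLE n :=
    isLE_obj₃ hT n (TStructure.t.isLE_of_le _ (n - 1) (n + 1)) inferInstance
  obtain ⟨Y, ⟨e⟩⟩ := exists_iso_singleFunctor_obj_of_isGE_of_isLE B n
  have h₂ : (g ≫ e.hom) ≫ e.inv = g := by simp
  have h₃ : (e.inv ≫ h) ≫ (𝟙 A)⟦(1 : ℤ)⟧' = e.inv ≫ h := by simp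
  refine ⟨Y, A, f, g ≫ e.hom, e.inv ≫ h, isomorphic_distinguished _ hT _ ?_, hA'⟩
  exact Triangle.isoMk _ _ (Iso.refl A) (Iso.refl X) e.symm
    ((Category.comp_id f).trans (Category.id_comp f).symm)
    (h₂.trans (Category.id_comp g).symm) h₃

/-- A complex with cohomology in degrees `≥ n` receives a map from its cohomology in
degree `n`. -/
lemma exists_single_hom_of_isGE (X : DerivedCategory C) (n : ℤ) [X.IsGE n] :
    ∃ (Y : C) (B : DerivedCategory C) (f : (singleFunctor C n).obj Y ⟶ X) (g : X ⟶ B)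
      (h : B ⟶ ((singleFunctor C n).obj Y)⟦(1 : ℤ)⟧),
      Triangle.mk f g h ∈ distTriang _ ∧ B.IsGE (n + 1) := by
  obtain ⟨A, B, hA, hB, f, g, h, hT⟩ := TStructure.t.exists_triangle X n (n + 1) rfl
  have hB' : B.IsGE (n + 1) := ⟨hB⟩
  have : A.IsLE n := ⟨hA⟩
  have : A.IsGE n :=
    isGE_obj₁ hT n inferInstance (TStructure.t.isGE_of_ge _ (n - 1) (n + 1))
  obtain ⟨Y, ⟨e⟩⟩ := exists_iso_singleFunctor_obj_of_isGE_of_isLE A n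
  have h₃ : (h ≫ e.hom⟦(1 : ℤ)⟧') ≫ e.inv⟦(1 : ℤ)⟧' = h := by
    rw [Category.assoc, ← Functor.map_comp, e.hom_inv_id, CategoryTheory.Functor.map_id,
      Category.comp_id]
  refine ⟨Y, B, e.inv ≫ f, g, h ≫ e.hom⟦1⟧', isomorphic_distinguished _ hT _ ?_, hB'⟩
  exact Triangle.isoMk _ _ e.symm (Iso.refl X) (Iso.refl B)
    (Category.comp_id (e.inv ≫ f)) ((Category.comp_id g).trans (Category.id_comp g).symm)
    (h₃.trans (Category.id_comp h).symm)

instance isKInjective_single (I : C) [Injective I] (n : ℤ) :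
    ((CochainComplex.singleFunctor C n).obj I).IsKInjective := by
  have (m : ℤ) : Injective (((CochainComplex.singleFunctor C n).obj I).X m) := by
    by_cases hm : m = n
    · subst hm
      exact Injective.of_iso (HomologicalComplex.singleObjXSelf (.up ℤ) m I).symm inferInstance
    · exact Injective.of_iso
        (((HomologicalComplex.isZero_single_obj_X (.up ℤ) n I m hm).iso (isZero_zero C)).symm)
        inferInstance
  exact CochainComplex.isKInjective_of_injective _ n

/-- There are no nonzero maps from a complex in degrees `> n` to an injective object placed in
degree `n`. -/
lemma hom_single_injective_eq_zero {X : DerivedCategory C} {I : C} [Injective I] {n : ℤ}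
    [X.IsGE (n + 1)] (f : X ⟶ (singleFunctor C n).obj I) : f = 0 := by
  obtain ⟨K, _, ⟨e⟩⟩ := X.exists_iso_Q_obj_of_isGE (n + 1)
  let e' : Qh.obj ((HomotopyCategory.quotient _ _).obj K) ≅ X :=
    (quotientCompQhIso C).app K ≪≫ e.symm
  let e'' : Qh.obj ((HomotopyCategory.quotient _ _).obj
      ((CochainComplex.singleFunctor C n).obj I)) ≅ (singleFunctor C n).obj I :=
    (quotientCompQhIso C).app _
  -- The target is K-injective, so the map comes from a chain map, which vanishes for degree
  -- reasons.
  obtain ⟨g, hg⟩ := (CochainComplex.IsKInjective.Qh_map_bijective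
    ((HomotopyCategory.quotient _ _).obj K)
    ((CochainComplex.singleFunctor C n).obj I)).2 (e'.hom ≫ f ≫ e''.inv)
  obtain ⟨g, rfl⟩ := (HomotopyCategory.quotient _ _).map_surjective g
  obtain rfl : g = 0 := by
    ext m
    by_cases hm : m = n
    · exact (K.isZero_of_isStrictlyGE (n + 1) m).eq_of_src _ _
    · exact (HomologicalComplex.isZero_single_obj_X (.up ℤ) n I m hm).eq_of_tgt _ _
  rw [← cancel_epi e'.hom, ← cancel_mono e''.inv, Category.assoc, ← hg, Functor.map_zero,
    DerivedCategory.Qh.map_zero, comp_zero, zero_comp]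

/-- Injectivity of `Hom(X, I[-n]) ⟶ Hom(H^n X, I)`. On `τ_{≤n} X` the map factors through
`H^n(X)[-n]`, where `H^n` detects it; what remains factors through `τ_{>n} X`. -/
lemma hom_single_eq_zero_of_homology {X : DerivedCategory C} {I : C} [Injective I] {n : ℤ}
    (f : X ⟶ (singleFunctor C n).obj I) (hf : (homologyFunctor C n).map f = 0) : f = 0 := by
  obtain ⟨A, B, hA, hB, a, b, c, hT⟩ := TStructure.t.exists_triangle X n (n + 1) rfl
  have : A.IsLE n := ⟨hA⟩
  have : B.IsGE (n + 1) := ⟨hB⟩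
  obtain ⟨Y, A', p, q, r, hT', hA'⟩ := exists_hom_single_of_isLE A n
  obtain ⟨g, hg⟩ : ∃ g, a ≫ f = q ≫ g :=
    Triangle.yoneda_exact₂ _ hT' (a ≫ f) (TStructure.t.zero_of_isLE_of_isGE (p ≫ a ≫ f) (n - 1) n (by lia) hA' inferInstance)
  have := isIso_homology_mor₂ hT' n hA'
  obtain ⟨g, rfl⟩ := (singleFunctor C n).map_surjective g
  have hg' : (homologyFunctor C n).map ((singleFunctor C n).map g) = 0 := by
    rw [← cancel_epi ((homologyFunctor C n).map q), ← Functor.map_comp, ← hg, Functor.map_comp,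
      hf, comp_zero, comp_zero]
  obtain rfl : g = 0 := by
    have := (singleFunctorCompHomologyFunctorIso C n).hom.naturality g
    dsimp at this
    rw [hg', zero_comp] at this
    rw [← cancel_epi ((singleFunctorCompHomologyFunctorIso C n).hom.app Y)]
    simpa using this.symm
  have hg₀ : a ≫ f = 0 := by rw [hg, Functor.map_zero, comp_zero]
  obtain ⟨k, hk⟩ : ∃ k, f = b ≫ k := Triangle.yoneda_exact₂ _ hT f hg₀
  rw [hk, hom_single_injective_eq_zero k, comp_zero]

/-- Surjectivity of the same map: `φ` defines a map on `τ_{≤n} X`, and the obstruction to extending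
it to `X` lies in `Hom((τ_{>n} X)[-1], I[-n]) = 0`. -/
lemma exists_hom_single_of_homology {X : DerivedCategory C} {I : C} [Injective I] {n : ℤ}
    (φ : (homologyFunctor C n).obj X ⟶ I) :
    ∃ f : X ⟶ (singleFunctor C n).obj I,
      (homologyFunctor C n).map f ≫ (singleFunctorCompHomologyFunctorIso C n).hom.app I = φ := by
  obtain ⟨A, B, hA, hB, a, b, c, hT⟩ := TStructure.t.exists_triangle X n (n + 1) rfl
  have : A.IsLE n := ⟨hA⟩
  have hB' : B.IsGE (n + 1) := ⟨hB⟩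
  obtain ⟨Y, A', p, q, r, hT', hA'⟩ := exists_hom_single_of_isLE A n
  have := isIso_homology_mor₂ hT' n hA'
  have := isIso_homology_mor₁ hT n hB'
  let g : Y ⟶ I := (singleFunctorCompHomologyFunctorIso C n).inv.app Y ≫
    inv ((homologyFunctor C n).map q) ≫ (homologyFunctor C n).map a ≫ φ
  obtain ⟨f, hf⟩ : ∃ f, q ≫ (singleFunctor C n).map g = a ≫ f :=
    Triangle.yoneda_exact₂ _ (inv_rot_of_distTriang _ hT)
    (q ≫ (singleFunctor C n).map g) (by
      have : (B⟦(-1 : ℤ)⟧).IsGE (n + 1 + 1) := TStructure.t.isGE_shift _ (n + 1) (-1) _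
      have : (B⟦(-1 : ℤ)⟧).IsGE (n + 1) := TStructure.t.isGE_of_ge _ _ (n + 1 + 1)
      exact hom_single_injective_eq_zero (X := B⟦(-1 : ℤ)⟧) _)
  refine ⟨f, ?_⟩
  rw [← cancel_epi ((homologyFunctor C n).map a), ← Functor.map_comp_assoc, ← hf,
    Functor.map_comp, Category.assoc]
  have := (singleFunctorCompHomologyFunctorIso C n).hom.naturality g
  dsimp at this
  rw [this]
  simp [g]

end SingleInjective

/-! ### Powers of an object indexed by Hom sets. -/

section Power

universe v' u₁' u₂'

variable {D : Type u₁'} [Category.{v'} D] {M : Type u₂'} [Category.{v'} M] [HasProducts.{v'} M]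

/-- The functor `X ↦ I^{Hom(X, E)}`. -/
def homPower (E : D) (I : M) : D ⥤ M where
  obj X := ∏ᶜ fun _ : X ⟶ E => I
  map u := Pi.lift fun φ => Pi.π _ (u ≫ φ)
  map_id X := by ext; simp
  map_comp f g := by ext; simp

namespace homPower

variable {E X Y : D} {I N : M}

/-- The projections of a power of `I`. -/
def π (I : M) (φ : X ⟶ E) : (homPower E I).obj X ⟶ I :=
  Pi.π (fun _ : X ⟶ E => I) φ

@[ext]
lemma hom_ext {f g : N ⟶ (homPower E I).obj X} (h : ∀ φ : X ⟶ E, f ≫ π I φ = g ≫ π I φ) :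
    f = g :=
  Pi.hom_ext f g h

/-- Morphisms to a power of `I`. -/
def lift (f : ∀ _ : X ⟶ E, N ⟶ I) : N ⟶ (homPower E I).obj X := Pi.lift f

@[simp]
lemma lift_π (f : ∀ _ : X ⟶ E, N ⟶ I) (φ : X ⟶ E) : lift f ≫ π I φ = f φ :=
  Pi.lift_π _ _

@[simp]
lemma map_π (u : X ⟶ Y) (φ : Y ⟶ E) : (homPower E I).map u ≫ π I φ = π I (u ≫ φ) :=
  Pi.lift_π _ _

instance [Injective I] : Injective ((homPower E I).obj X) :=
  inferInstanceAs (Injective (∏ᶜ fun _ : X ⟶ E => I))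

end homPower

end Power

/-! ### Vanishing of the cohomology of a Kan extension. -/

section PointwiseVanishing

universe v₁ v₂ u₁ u₂ u₃

open DerivedCategory

variable {M : Type u₃} [Category.{v₂} M] [Abelian M] [HasDerivedCategory.{w₁} M]

/-- The cohomology in degree `n` of an object placed in degree `n`, in `D^+`. -/
def homologyPlusSingleIso (n : ℤ) (I : M) :
    (Plus.homologyFunctor M n).obj ((Plus.singleFunctor M n).obj I) ≅ I :=
  (singleFunctorCompHomologyFunctorIso M n).app I

lemma homologyPlusSingleIso_naturality (n : ℤ) {I J : M} (f : I ⟶ J) :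
    (Plus.homologyFunctor M n).map ((Plus.singleFunctor M n).map f) ≫
      (homologyPlusSingleIso n J).hom = (homologyPlusSingleIso n I).hom ≫ f :=
  (singleFunctorCompHomologyFunctorIso M n).hom.naturality f

lemma plus_hom_single_ext {X : DerivedCategory.Plus M} {I : M} [Injective I] {n : ℤ}
    {f g : X ⟶ (Plus.singleFunctor M n).obj I}
    (h : (Plus.homologyFunctor M n).map f ≫ (homologyPlusSingleIso n I).hom =
      (Plus.homologyFunctor M n).map g ≫ (homologyPlusSingleIso n I).hom) : f = g := by
  rw [cancel_mono] at h
  rw [← sub_eq_zero]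
  apply Plus.ι.map_injective
  rw [Functor.map_zero]
  apply hom_single_eq_zero_of_homology
  change (Plus.homologyFunctor M n).map (f - g) = 0
  rw [Functor.map_sub, h, sub_self]

lemma exists_plus_hom_single {X : DerivedCategory.Plus M} {I : M} [Injective I] {n : ℤ}
    (φ : (Plus.homologyFunctor M n).obj X ⟶ I) :
    ∃ f : X ⟶ (Plus.singleFunctor M n).obj I,
      (Plus.homologyFunctor M n).map f ≫ (homologyPlusSingleIso n I).hom = φ := by
  obtain ⟨f, hf⟩ := exists_hom_single_of_homology (X := X.obj) φ
  exact ⟨ObjectProperty.homMk f, hf⟩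

variable {K : Type u₁} {D : Type u₂} [Category.{v₁} K] [Category.{v₂} D] [HasProducts.{v₂} M]
  [EnoughInjectives M]

/-- If a functor `RF` with values in `D^+(M)` is a left Kan extension of `F` along `L`, then the
cohomology of `RF(E)` is determined by the maps from `F(K)` for the maps `L(K) ⟶ E`. -/
lemma isZero_homology_of_isLeftKanExtension {L : K ⥤ D} {F : K ⥤ DerivedCategory.Plus M}
    {RF : D ⥤ DerivedCategory.Plus M} (α : F ⟶ L ⋙ RF) [RF.IsLeftKanExtension α]
    (E : D) (n : ℤ)
    (h : ∀ (X : K) (φ : L.obj X ⟶ E),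
      (Plus.homologyFunctor M n).map (α.app X ≫ RF.map φ) = 0) :
    IsZero ((Plus.homologyFunctor M n).obj (RF.obj E)) := by
  let H := Plus.homologyFunctor M n
  let I : M := Injective.under (H.obj (RF.obj E))
  let ι : H.obj (RF.obj E) ⟶ I := Injective.ι _
  -- The power makes `G` a functor of `X`; its projection at `𝟙 E` recovers `ι` from `β` at `E`.
  let G : D ⥤ DerivedCategory.Plus M := homPower E I ⋙ Plus.singleFunctor M n
  let b (X : D) : H.obj (RF.obj X) ⟶ (homPower E I).obj X :=
    homPower.lift fun φ => H.map (RF.map φ) ≫ ι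
  let β : RF ⟶ G :=
    { app X := (exists_plus_hom_single (b X)).choose
      naturality X Y f := by
        apply plus_hom_single_ext
        rw [Functor.map_comp, Functor.map_comp, Category.assoc, Category.assoc,
          (exists_plus_hom_single (b Y)).choose_spec]
        dsimp only [G, Functor.comp_map]
        rw [homologyPlusSingleIso_naturality, ← Category.assoc,
          (exists_plus_hom_single (b X)).choose_spec]
        refine homPower.hom_ext fun φ => ?_
        rw [Category.assoc, Category.assoc, homPower.map_π, homPower.lift_π, homPower.lift_π,
          RF.map_comp, H.map_comp, Category.assoc] }
  have hβ (X : D) : H.map (β.app X) ≫ (homologyPlusSingleIso n _).hom = b X :=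
    (exists_plus_hom_single (b X)).choose_spec
  -- By the universal property, it suffices to check after composing with `α`, where `h` applies.
  have : β = 0 := by
    apply RF.hom_ext_of_isLeftKanExtension α
    ext X : 2
    apply plus_hom_single_ext
    rw [NatTrans.comp_app, NatTrans.comp_app, Functor.map_comp, Functor.map_comp,
      Category.assoc, Category.assoc]
    refine (congrArg (_ ≫ ·) (hβ (L.obj X))).trans (Eq.trans ?_
      (show 0 = H.map (α.app X) ≫ H.map 0 ≫ _ by rw [Functor.map_zero, zero_comp, comp_zero]))
    refine homPower.hom_ext fun φ => ?_
    have := h X φ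
    rw [Functor.map_comp] at this
    rw [Category.assoc, homPower.lift_π, ← Category.assoc, this, zero_comp, zero_comp]
  have hι : ι = 0 := by
    have h₁ := hβ E
    rw [this] at h₁
    have h₂ := congr($h₁ ≫ homPower.π I (𝟙 E))
    simpa [b, H] using h₂.symm
  have : Mono ι := inferInstanceAs (Mono (Injective.ι _))
  exact (IsZero.iff_id_eq_zero _).2 (by rw [← cancel_mono ι, hι, comp_zero, comp_zero])

end PointwiseVanishing

/-! ### Cohomology of `RHom(T, -)`. -/

section RHomVanishing

open DerivedCategory

variable {Z : Type u} [Category.{v} Z] [Abelian Z]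

/-- Every element of the cohomology of the complex `Hom(T, K)` comes from a morphism of complexes
from `T`, placed in the corresponding degree, to `K`. -/
lemma exists_hom_single_homologyMap_eq (T : Z) (K : CochainComplex Z ℤ) (n : ℤ)
    (x : (((preadditiveCoyonedaObj T).mapHomologicalComplex (.up ℤ)).obj K).homology n) :
    ∃ (f : (CochainComplex.singleFunctor Z n).obj T ⟶ K)
      (y : (((preadditiveCoyonedaObj T).mapHomologicalComplex (.up ℤ)).obj
        ((CochainComplex.singleFunctor Z n).obj T)).homology n),
      HomologicalComplex.homologyMap
        (((preadditiveCoyonedaObj T).mapHomologicalComplex (.up ℤ)).map f) n y = x := by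
  let F := (preadditiveCoyonedaObj T).mapHomologicalComplex (.up ℤ)
  let S := (CochainComplex.singleFunctor Z n).obj T
  obtain ⟨c, hc⟩ := (ModuleCat.epi_iff_surjective ((F.obj K).homologyπ n)).1 inferInstance x
  -- A degree-`n` cocycle of `Hom(T, K)` is a map `T ⟶ K^n` killed by the differential, hence a
  -- chain map.
  let z : T ⟶ K.X n := (F.obj K).iCycles n c
  have hz : z ≫ K.d n (n + 1) = 0 := by
    have := (F.obj K).iCycles_d n (n + 1)
    exact congr($this c)
  let f : S ⟶ K := HomologicalComplex.mkHomFromSingle z (fun k hk => by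
    obtain rfl : n + 1 = k := hk
    exact hz)
  let s : T ⟶ S.X n := (HomologicalComplex.singleObjXSelf (.up ℤ) n T).inv
  have hs : (F.obj S).d n (n + 1) s = 0 :=
    (HomologicalComplex.isZero_single_obj_X (.up ℤ) n T (n + 1) (by simp)).eq_of_tgt
      (s ≫ S.d n (n + 1)) 0
  obtain ⟨e, he⟩ : ∃ e : (F.obj S).cycles n, (F.obj S).iCycles n e = s :=
    ⟨(F.obj S).cyclesMk s (n + 1) (by simp) hs, (F.obj S).i_cyclesMk s (n + 1) (by simp) hs⟩
  refine ⟨f, (F.obj S).homologyπ n e, ?_⟩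
  have h₁ := HomologicalComplex.homologyπ_naturality (F.map f) n
  have h₂ : HomologicalComplex.cyclesMap (F.map f) n e = c := by
    apply (ModuleCat.mono_iff_injective ((F.obj K).iCycles n)).1 inferInstance
    have h₃ := HomologicalComplex.cyclesMap_i (F.map f) n
    refine (congr($h₃ e)).trans ?_
    change (F.map f).f n ((F.obj S).iCycles n e) = z
    rw [he]
    change s ≫ f.f n = z
    rw [HomologicalComplex.mkHomFromSingle_f]
    exact (HomologicalComplex.singleObjXSelf (.up ℤ) n T).inv_hom_id_assoc z
  rw [← hc, ← h₂]
  exact congr($h₁ e)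

variable (T : Z) [HasDerivedCategory.{w₂} (ModuleCat.{v} (End T)ᵐᵒᵖ)]

/-- The cohomology of `Hom(T, K)`, before and after passing to the derived category. -/
def homologyHomComplexIso (n : ℤ) :
    CochainComplex.Plus.ι Z ⋙ (preadditiveCoyonedaObj T).mapHomologicalComplex (.up ℤ) ⋙
        HomologicalComplex.homologyFunctor _ _ n ≅
      HomotopyCategory.Plus.quotient Z ⋙ homComplex.{w₂} T ⋙ Plus.homologyFunctor _ n :=
  Functor.isoWhiskerLeft
    (CochainComplex.Plus.ι Z ⋙ (preadditiveCoyonedaObj T).mapHomologicalComplex (.up ℤ))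
    ((homologyFunctorFactors _ n).symm ≪≫
      Functor.isoWhiskerRight (quotientCompQhIso _).symm (homologyFunctor _ n))

lemma homology_map_eq_zero_of_single {K : HomotopyCategory.Plus Z}
    {Y : DerivedCategory.Plus (ModuleCat.{v} (End T)ᵐᵒᵖ)} (n : ℤ)
    (g : (homComplex.{w₂} T).obj K ⟶ Y)
    (h : ∀ f : (HomotopyCategory.Plus.singleFunctor Z n).obj T ⟶ K,
      (homComplex.{w₂} T).map f ≫ g = 0) :
    (Plus.homologyFunctor _ n).map g = 0 := by
  obtain ⟨⟨K, hK⟩, rfl⟩ := HomotopyCategory.Plus.quotient_obj_surjective K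
  let e := homologyHomComplexIso.{w₂} T n
  rw [← cancel_epi (e.hom.app ⟨K, hK⟩), comp_zero]
  ext x
  obtain ⟨f, y, rfl⟩ := exists_hom_single_homologyMap_eq T K n x
  let S : CochainComplex.Plus Z := ⟨(CochainComplex.singleFunctor Z n).obj T, ⟨n, inferInstance⟩⟩
  let f' : S ⟶ ⟨K, hK⟩ := ObjectProperty.homMk f
  have h₁ := e.hom.naturality f'
  have h₂ : (homComplex.{w₂} T).map ((HomotopyCategory.Plus.quotient Z).map f') ≫ g = 0 := h _
  have h₃ := congr($h₁ ≫ (Plus.homologyFunctor _ n).map g)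
  rw [Category.assoc, Category.assoc, Functor.comp_map (HomotopyCategory.Plus.quotient Z),
    Functor.comp_map (homComplex.{w₂} T), ← Functor.map_comp, h₂, Functor.map_zero,
    comp_zero] at h₃
  exact congr($h₃ y)

variable [HasDerivedCategory.{v} Z]

/-- If `Hom(T[-n], E) = 0` in the derived category, then `H^n(RHom(T, E)) = 0`. -/
lemma isZero_homology_RHom [HasRHom.{w₂} T] (E : DerivedCategory.Plus Z) (n : ℤ)
    (h : ∀ f : (Plus.singleFunctor Z n).obj T ⟶ E, f = 0) :
    IsZero ((Plus.homologyFunctor _ n).obj ((RHom.{w₂} T).obj E)) := by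
  let α : homComplex.{w₂} T ⟶ Plus.Qh ⋙ RHom.{w₂} T := (homComplex.{w₂} T).totalRightDerivedUnit DerivedCategory.Plus.Qh
    (HomotopyCategory.Plus.quasiIso Z)
  have : (RHom.{w₂} T).IsRightDerivedFunctor α (HomotopyCategory.Plus.quasiIso Z) :=
    inferInstanceAs (((homComplex.{w₂} T).totalRightDerived DerivedCategory.Plus.Qh
      (HomotopyCategory.Plus.quasiIso Z)).IsRightDerivedFunctor
        ((homComplex.{w₂} T).totalRightDerivedUnit DerivedCategory.Plus.Qh
          (HomotopyCategory.Plus.quasiIso Z)) (HomotopyCategory.Plus.quasiIso Z))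
  have : (RHom.{w₂} T).IsLeftKanExtension α :=
    Functor.IsRightDerivedFunctor.isLeftKanExtension _ _ (HomotopyCategory.Plus.quasiIso Z)
  refine isZero_homology_of_isLeftKanExtension (RF := RHom.{w₂} T) α E n fun K φ => ?_
  apply homology_map_eq_zero_of_single
  intro f
  have (f : (HomotopyCategory.Plus.singleFunctor Z n).obj T ⟶ K) :
      (homComplex.{w₂} T).map f ≫ α.app K ≫ (RHom.{w₂} T).map φ =
        α.app _ ≫ (RHom.{w₂} T).map 0 := by
    have h₁ := α.naturality f
    have h₂ : Plus.Qh.map f ≫ φ = 0 := h _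
    rw [← h₂, Functor.map_comp, ← Category.assoc, h₁, Category.assoc]
    rfl
  -- The right side of `this` does not depend on `f`, so comparison with `f = 0` needs only
  -- additivity of `homComplex`, not of `RHom`.
  rw [this f, ← this 0, Functor.map_zero, zero_comp]

end RHomVanishing

/-! ### Detecting cohomological bounds by maps to and from single objects. -/

section DerivedCategoryLemmas

universe v₁ v₂ u₁ u₂

open DerivedCategory Pretriangulated

/-- An exact faithful functor detects the vanishing of the cohomology of complexes. -/
lemma isZero_homology_of_mapDerivedCategory {C : Type u₁} [Category.{v₁} C] [Abelian C]
    [HasDerivedCategory.{w₁} C] {D : Type u₂} [Category.{v₂} D] [Abelian D]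
    [HasDerivedCategory.{w₂} D] (F : C ⥤ D) [F.Additive] [PreservesFiniteLimits F]
    [PreservesFiniteColimits F] [F.Faithful] (X : DerivedCategory C) (n : ℤ)
    (h : IsZero ((homologyFunctor D n).obj (F.mapDerivedCategory.obj X))) :
    IsZero ((homologyFunctor C n).obj X) := by
  let K := Q.objPreimage X
  let e : Q.obj K ≅ X := Q.objObjPreimageIso X
  let e₁ : (homologyFunctor C n).obj X ≅ K.homology n :=
    (homologyFunctor C n).mapIso e.symm ≪≫ (homologyFunctorFactors C n).app K
  let e₂ : (homologyFunctor D n).obj (F.mapDerivedCategory.obj X) ≅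
      ((F.mapHomologicalComplex (.up ℤ)).obj K).homology n :=
    (homologyFunctor D n).mapIso (F.mapDerivedCategory.mapIso e.symm ≪≫
      F.mapDerivedCategoryFactors.app K) ≪≫ (homologyFunctorFactors D n).app _
  let e₃ : ((F.mapHomologicalComplex (.up ℤ)).obj K).homology n ≅ F.obj (K.homology n) :=
    (K.sc n).mapHomologyIso F
  have h₀ : IsZero (F.obj (K.homology n)) := h.of_iso (e₂ ≪≫ e₃).symm
  refine IsZero.of_iso ?_ e₁
  rw [IsZero.iff_id_eq_zero]
  exact F.map_injective (h₀.eq_of_src _ _)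

variable {C : Type u} [Category.{v} C] [Abelian C] [HasDerivedCategory.{w₁} C]

/-- Descending induction on the upper bound: the projection to the top cohomology is zero, yet an
isomorphism on that cohomology. -/
lemma isLE_of_forall_hom_single_eq_zero (X : DerivedCategory C) (m N : ℤ) (hN : X.IsLE N)
    (h : ∀ (E : C) (j : ℤ), m < j → ∀ f : X ⟶ (singleFunctor C j).obj E, f = 0) :
    X.IsLE m := by
  suffices ∀ k : ℕ, X.IsLE (m + k) → X.IsLE m from
    this (N - m).toNat (TStructure.t.isLE_of_le X N _)
  intro k
  induction k with
  | zero => intro h; simpa using h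
  | succ k ih =>
    intro hk
    refine ih ?_
    obtain ⟨Y, A, f, g, _, hT, hA⟩ := exists_hom_single_of_isLE X (m + (k + 1 : ℕ))
    have := isIso_homology_mor₂ hT _ hA
    rw [isLE_iff]
    intro i hi
    obtain rfl | hi : i = m + (k + 1 : ℕ) ∨ m + (k + 1 : ℕ) < i := by lia
    · exact IsZero.of_mono_eq_zero ((homologyFunctor C _).map g)
        (by rw [h Y _ (by lia) g, Functor.map_zero])
    · exact isZero_of_isLE X _ i hi

lemma isGE_of_forall_single_hom_eq_zero (X : DerivedCategory C) (m N : ℤ) (hN : X.IsGE N)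
    (h : ∀ (E : C) (j : ℤ), j < m → ∀ f : (singleFunctor C j).obj E ⟶ X, f = 0) :
    X.IsGE m := by
  suffices ∀ k : ℕ, X.IsGE (m - k) → X.IsGE m from
    this (m - N).toNat (TStructure.t.isGE_of_ge X _ N)
  intro k
  induction k with
  | zero => intro h; simpa using h
  | succ k ih =>
    intro hk
    refine ih ?_
    obtain ⟨Y, B, f, g, _, hT, hB⟩ := exists_single_hom_of_isGE X (m - (k + 1 : ℕ))
    have := isIso_homology_mor₁ hT _ hB
    rw [isGE_iff]
    intro i hi
    obtain rfl | hi : i = m - (k + 1 : ℕ) ∨ i < m - (k + 1 : ℕ) := by lia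
    · exact IsZero.of_epi_eq_zero ((homologyFunctor C _).map f)
        (by rw [h Y _ (by lia) f, Functor.map_zero])
    · exact isZero_of_isGE X _ i hi

/-- Shifting by `i` turns `f` into an element of `Ext^{i-j}(E, F)`. -/
lemma HasHomologicalDimension.hom_single_eq_zero {d : ℕ} (hd : HasHomologicalDimension C d)
    (E F : C) (i j : ℤ) (hij : i - j ∉ Set.Icc (0 : ℤ) d)
    (f : (singleFunctor C i).obj E ⟶ (singleFunctor C j).obj F) : f = 0 := by
  have := hd E F (i - j) hij
  let e₁ : ((singleFunctor C i).obj E)⟦i⟧ ≅ (singleFunctor C 0).obj E :=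
    ((singleFunctors C).shiftIso i 0 i (by lia)).app E
  let e₂ : ((singleFunctor C j).obj F)⟦i⟧ ≅ (singleFunctor C (j - i)).obj F :=
    ((singleFunctors C).shiftIso i (j - i) j (by lia)).app F
  let e₃ : ((singleFunctor C 0).obj F)⟦i - j⟧ ≅ (singleFunctor C (j - i)).obj F :=
    ((singleFunctors C).shiftIso (i - j) (j - i) 0 (by lia)).app F
  apply (shiftFunctor (DerivedCategory C) i).map_injective
  rw [Functor.map_zero, ← cancel_epi e₁.inv, ← cancel_mono (e₂.hom ≫ e₃.inv)]
  exact Subsingleton.elim (α := ExtGroup E F (i - j)) _ _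

/-- The inclusion of an abelian category in its bounded derived category, as complexes
concentrated in degree `n`. -/
def singleBounded (C : Type u) [Category.{v} C] [Abelian C] [HasDerivedCategory.{w₁} C]
    (n : ℤ) : C ⥤ DerivedCategory.Bounded C :=
  DerivedCategory.TStructure.t.bounded.lift (DerivedCategory.singleFunctor C n)
    (fun _ => ⟨⟨n, inferInstance⟩, ⟨n, inferInstance⟩⟩)

end DerivedCategoryLemmas

variable {Z : Type u} [Category.{v} Z] [Abelian Z] [HasDerivedCategory.{v} Z] {T : Z}
  [IsNoetherianRing (End T)ᵐᵒᵖ]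
  [HasDerivedCategory.{w₁} (RightMod T)] [HasDerivedCategory.{w₂} (ModuleCat.{v} (End T)ᵐᵒᵖ)]
  (t : Tilting.{w₁, w₂} T)

/-! ### The degrees in which `Φ` of an object of `Z` lives. -/

namespace Tilting

open DerivedCategory Pretriangulated

/-- The only use of the identification of `Φ` with `RHom(T, -)`; the rest of the argument needs
these bounds and a triangulated equivalence. -/
lemma isZero_homology_Φ (X : Bounded Z) (n : ℤ)
    (h : ∀ f : (singleFunctor Z n).obj T ⟶ X.obj, f = 0) :
    IsZero ((homologyFunctor _ n).obj (t.Φ.functor.obj X).obj) := by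
  have := t.hasRHom
  apply isZero_homology_of_mapDerivedCategory (forget₂ (RightMod T) (ModuleCat.{v} (End T)ᵐᵒᵖ))
  refine IsZero.of_iso ?_ ((homologyFunctor _ n).mapIso (t.isoRHom.app X))
  refine isZero_homology_RHom.{w₂} T ((boundedToPlus Z).obj X) n fun f => ?_
  apply Plus.ι.map_injective
  rw [Functor.map_zero]
  exact h _

lemma isGE_Φ_singleBounded (hdim : HasHomologicalDimension Z 2) (E : Z) (j : ℤ) :
    (t.Φ.functor.obj ((singleBounded Z j).obj E)).obj.IsGE j := by
  rw [isGE_iff]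
  intro i hi
  exact t.isZero_homology_Φ _ i fun f =>
    hdim.hom_single_eq_zero _ _ _ _ (by rw [Set.mem_Icc]; lia) f

lemma isLE_Φ_singleBounded (hdim : HasHomologicalDimension Z 2) (E : Z) (j : ℤ) :
    (t.Φ.functor.obj ((singleBounded Z j).obj E)).obj.IsLE (j + 2) := by
  rw [isLE_iff]
  intro i hi
  exact t.isZero_homology_Φ _ i fun f =>
    hdim.hom_single_eq_zero _ _ _ _ (by rw [Set.mem_Icc]; lia) f

end Tilting

section Bounded

open DerivedCategory

variable {C : Type u} [Category.{v} C] [Abelian C] [HasDerivedCategory.{w₁} C]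

lemma isGE_toBounded (M : C) : ((toBounded C).obj M).obj.IsGE 0 :=
  inferInstanceAs (((singleFunctor C 0).obj M).IsGE 0)

lemma isLE_toBounded (M : C) : ((toBounded C).obj M).obj.IsLE 0 :=
  inferInstanceAs (((singleFunctor C 0).obj M).IsLE 0)

lemma bounded_hom_eq_zero {X Y : Bounded C} (f : X ⟶ Y) (n₀ n₁ : ℤ) (h : n₀ < n₁)
    (hX : X.obj.IsLE n₀) (hY : Y.obj.IsGE n₁) : f = 0 := by
  apply Bounded.ι.map_injective
  rw [Functor.map_zero]
  exact TStructure.t.zero_of_isLE_of_isGE _ n₀ n₁ h hX hY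

lemma bounded_isGE_of_iso {X Y : Bounded C} (e : X ≅ Y) (n : ℤ) (h : X.obj.IsGE n) :
    Y.obj.IsGE n := by
  have : (Bounded.ι.obj X).IsGE n := h
  exact TStructure.t.isGE_of_iso (Bounded.ι.mapIso e) n

end Bounded

variable {Z : Type u} [Category.{v} Z] [Abelian Z] [HasDerivedCategory.{v} Z] {T : Z}
  [IsNoetherianRing (End T)ᵐᵒᵖ]
  [HasDerivedCategory.{w₁} (RightMod T)] [HasDerivedCategory.{w₂} (ModuleCat.{v} (End T)ᵐᵒᵖ)]
  (t : Tilting.{w₁, w₂} T)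

/-! ### The degrees of `Ψ(M)` and the closure properties of `C_0`. -/

namespace Tilting

open DerivedCategory Pretriangulated

/-- The object `Ψ(M)` of the bounded derived category of `Z`. -/
abbrev Ψ (M : RightMod T) : Bounded Z := t.Φ.inverse.obj ((toBounded (RightMod T)).obj M)

/-- The isomorphism `Φ(Ψ(M)) ≅ M`. -/
abbrev ΦΨIso (M : RightMod T) : t.Φ.functor.obj (t.Ψ M) ≅ (toBounded (RightMod T)).obj M :=
  t.Φ.counitIso.app _

lemma hom_Ψ_single_eq_zero {M : RightMod T} {E : Z} {j : ℤ}
    (h : ∀ g : (toBounded (RightMod T)).obj M ⟶ t.Φ.functor.obj ((singleBounded Z j).obj E), g = 0)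
    (f : (t.Ψ M).obj ⟶ (singleFunctor Z j).obj E) : f = 0 := by
  let f' : t.Ψ M ⟶ (singleBounded Z j).obj E := ObjectProperty.homMk f
  suffices f' = 0 from congr(Bounded.ι.map $this).trans (Functor.map_zero _ _ _)
  apply t.Φ.functor.map_injective
  rw [← cancel_epi (t.ΦΨIso M).inv, h ((t.ΦΨIso M).inv ≫ t.Φ.functor.map f'),
    t.Φ.functor.map_zero, comp_zero]

lemma single_hom_Ψ_eq_zero {M : RightMod T} {E : Z} {j : ℤ}
    (h : ∀ g : t.Φ.functor.obj ((singleBounded Z j).obj E) ⟶ (toBounded (RightMod T)).obj M, g = 0)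
    (f : (singleFunctor Z j).obj E ⟶ (t.Ψ M).obj) : f = 0 := by
  let f' : (singleBounded Z j).obj E ⟶ t.Ψ M := ObjectProperty.homMk f
  suffices f' = 0 from congr(Bounded.ι.map $this).trans (Functor.map_zero _ _ _)
  apply t.Φ.functor.map_injective
  rw [← cancel_mono (t.ΦΨIso M).hom, h (t.Φ.functor.map f' ≫ (t.ΦΨIso M).hom),
    t.Φ.functor.map_zero, zero_comp]

/-- `Ψ(M)` has no cohomology in positive degrees. -/
lemma isLE_Ψ (hdim : HasHomologicalDimension Z 2) (M : RightMod T) : (t.Ψ M).obj.IsLE 0 := by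
  obtain ⟨N, hN⟩ := (t.Ψ M).property.2
  exact isLE_of_forall_hom_single_eq_zero _ 0 N hN fun E j hj =>
    t.hom_Ψ_single_eq_zero fun g => bounded_hom_eq_zero g 0 j hj (isLE_toBounded M)
      (t.isGE_Φ_singleBounded hdim E j)

/-- `Ψ(M)` has no cohomology in degrees `< -2`. -/
lemma isGE_Ψ (hdim : HasHomologicalDimension Z 2) (M : RightMod T) : (t.Ψ M).obj.IsGE (-2) := by
  obtain ⟨N, hN⟩ := (t.Ψ M).property.1
  exact isGE_of_forall_single_hom_eq_zero _ (-2) N hN fun E j hj =>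
    t.single_hom_Ψ_eq_zero fun g => bounded_hom_eq_zero g (j + 2) 0 (by lia)
      (t.isLE_Φ_singleBounded hdim E j) (isGE_toBounded M)

lemma isLE_Ψ_of_mem_C (hdim : HasHomologicalDimension Z 2) {M : RightMod T} (hM : t.C 0 M) :
    (t.Ψ M).obj.IsLE (-1) := by
  have := t.isLE_Ψ hdim M
  rw [isLE_iff]
  intro i hi
  obtain rfl | hi : i = 0 ∨ 0 < i := by lia
  · exact hM
  · exact isZero_of_isLE _ 0 i hi

/-- `Ψ^0(M) = 0` if and only if there are no nonzero maps from `M` to the objects `Φ(E)`. -/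
lemma mem_C_zero_iff (hdim : HasHomologicalDimension Z 2) (M : RightMod T) :
    t.C 0 M ↔ ∀ (E : Z) (f : (singleFunctor (RightMod T) 0).obj M ⟶
      (t.Φ.functor.obj ((singleBounded Z 0).obj E)).obj), f = 0 := by
  constructor
  · intro hM E f
    have := t.isLE_Ψ_of_mem_C hdim hM
    let f' : (toBounded (RightMod T)).obj M ⟶ t.Φ.functor.obj ((singleBounded Z 0).obj E) :=
      ObjectProperty.homMk f
    suffices f' = 0 from congr(Bounded.ι.map $this).trans (Functor.map_zero _ _ _)
    obtain ⟨g, hg⟩ := t.Φ.functor.map_surjective ((t.ΦΨIso M).hom ≫ f')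
    have hg₀ : g = 0 := by
      apply Bounded.ι.map_injective
      rw [Functor.map_zero]
      exact TStructure.t.zero_of_isLE_of_isGE _ (-1) 0 (by lia) this
        (inferInstanceAs (((singleFunctor Z 0).obj E).IsGE 0))
    rw [← cancel_epi (t.ΦΨIso M).hom, ← hg, hg₀, t.Φ.functor.map_zero, comp_zero]
  · intro h
    have : (t.Ψ M).obj.IsLE (-1) :=
      isLE_of_forall_hom_single_eq_zero _ (-1) 0 (t.isLE_Ψ hdim M) fun E j hj => by
        obtain rfl | hj : j = 0 ∨ 0 < j := by lia
        · exact t.hom_Ψ_single_eq_zero fun g => Bounded.ι.map_injective (by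
            rw [Functor.map_zero]
            exact h E _)
        · exact t.hom_Ψ_single_eq_zero fun g => bounded_hom_eq_zero g 0 j hj (isLE_toBounded M)
            (t.isGE_Φ_singleBounded hdim E j)
    exact isZero_of_isLE (t.Ψ M).obj (-1) 0 (by lia)

/-- A map `X₃ ⟶ Φ(E)` vanishing on `X₂` factors through `X₁[1]`, which lies in degree `-1`, while
`Φ(E)` lies in degrees `≥ 0`. -/
lemma C_zero_X₃ (hdim : HasHomologicalDimension Z 2) {S : ShortComplex (RightMod T)}
    (hS : S.ShortExact) (h₂ : t.C 0 S.X₂) : t.C 0 S.X₃ := by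
  rw [mem_C_zero_iff t hdim] at h₂ ⊢
  intro E f
  obtain ⟨g, rfl⟩ : ∃ g, f = hS.singleδ ≫ g :=
    Triangle.yoneda_exact₃ _ hS.singleTriangle_distinguished f (h₂ E _)
  have : (((singleFunctor (RightMod T) 0).obj S.X₁)⟦(1 : ℤ)⟧).IsLE (-1) :=
    TStructure.t.isLE_shift _ 0 1 (-1)
  have hg : g = 0 := TStructure.t.zero_of_isLE_of_isGE g (-1) 0 (by lia) this
    (t.isGE_Φ_singleBounded hdim E 0)
  rw [hg, comp_zero]

lemma C_zero_X₂ (hdim : HasHomologicalDimension Z 2) {S : ShortComplex (RightMod T)}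
    (hS : S.ShortExact) (h₁ : t.C 0 S.X₁) (h₃ : t.C 0 S.X₃) : t.C 0 S.X₂ := by
  rw [mem_C_zero_iff t hdim] at h₁ h₃ ⊢
  intro E f
  obtain ⟨g, rfl⟩ : ∃ g, f = (singleFunctor (RightMod T) 0).map S.g ≫ g :=
    Triangle.yoneda_exact₂ _ hS.singleTriangle_distinguished f (h₁ E _)
  rw [h₃ E g, comp_zero]

instance (i : ℤ) : (t.C i).IsClosedUnderIsomorphisms where
  of_iso e h := IsZero.of_iso h ((t.cohomologyΨ i).mapIso e.symm)

lemma isZero_of_mem_C_zero (hdim : HasHomologicalDimension Z 2) {M : RightMod T}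
    (hM : t.C 0 M) (h₁ : (t.Y (-1)).rightOrthogonal M) (h₂ : (t.Y (-2)).rightOrthogonal M) :
    IsZero M := by
  have hX₁ := t.isLE_Ψ_of_mem_C hdim hM
  have hX₂ := t.isGE_Ψ hdim M
  obtain ⟨E, B, f, g, h, hT, hB⟩ := exists_single_hom_of_isGE (t.Ψ M).obj (-2)
  have hB₁ : B.IsLE (-1) := isLE_obj₃ hT (-1)
    (TStructure.t.isLE_of_le ((singleFunctor Z (-2)).obj E) (-2) (-1 + 1)) hX₁
  have hB₂ : B.IsGE (-1) := hB
  obtain ⟨F, ⟨e⟩⟩ := exists_iso_singleFunctor_obj_of_isGE_of_isLE B (-1)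
  let A' : Bounded Z := (singleBounded Z (-2)).obj E
  let f' : A' ⟶ t.Ψ M := ObjectProperty.homMk f
  obtain ⟨B', g', h', hT'⟩ := distinguished_cocone_triangle f'
  -- The cone taken in the bounded category agrees with `B`, hence with `Ψ^{-1}(M)[1]`.
  let e' : B' ≅ (singleBounded Z (-1)).obj F := Bounded.ι.preimageIso
    (Triangle.π₃.mapIso (isoTriangleOfIso₁₂ _ _ (Bounded.ι.map_distinguished _ hT') hT
      (Iso.refl _) (Iso.refl _) ((Category.comp_id f).trans (Category.id_comp f).symm)) ≪≫ e)
  let := t.commShift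
  have := t.isTriangulated
  have hT'' := Bounded.ι.map_distinguished _ (t.Φ.functor.map_distinguished _ hT')
  have hA₁ : (t.Φ.functor.obj A').obj.IsLE 0 := t.isLE_Φ_singleBounded hdim E (-2)
  have hB' : (t.Φ.functor.obj B').obj.IsGE (-1) :=
    bounded_isGE_of_iso (t.Φ.functor.mapIso e'.symm) (-1) (t.isGE_Φ_singleBounded hdim F (-1))
  have hM₂ : (t.Φ.functor.obj (t.Ψ M)).obj.IsGE 0 :=
    bounded_isGE_of_iso (t.ΦΨIso M).symm 0 (isGE_toBounded M)
  -- `Φ(A')` sits between `Φ(B')[-1]` and `Φ(Ψ(M))`, both in degrees `≥ 0`; with `hA₁` it is a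
  -- module.
  have hA₂ : (t.Φ.functor.obj A').obj.IsGE 0 := isGE_obj₁ hT'' 0 hM₂ hB'
  obtain ⟨N, ⟨a⟩⟩ := exists_iso_singleFunctor_obj_of_isGE_of_isLE (t.Φ.functor.obj A').obj 0
  let a' : t.Φ.functor.obj A' ≅ (toBounded (RightMod T)).obj N := Bounded.ι.preimageIso a
  let b : A' ≅ t.Ψ N := t.Φ.unitIso.app A' ≪≫ t.Φ.inverse.mapIso a'
  have hN : t.Y (-2) N := by
    intro j hj
    refine IsZero.of_iso ?_ ((boundedCohomology Z j).mapIso b.symm)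
    obtain hj | hj := lt_or_gt_of_ne hj
    · exact isZero_of_isGE ((singleFunctor Z (-2)).obj E) (-2) j hj
    · exact isZero_of_isLE ((singleFunctor Z (-2)).obj E) (-2) j hj
  have hf : f = 0 := by
    refine t.single_hom_Ψ_eq_zero (fun k => ?_) f
    obtain ⟨c, hc⟩ := (singleFunctor (RightMod T) 0).map_surjective
      (Bounded.ι.map (a'.inv ≫ k))
    rw [h₂ c hN, Functor.map_zero] at hc
    rw [← cancel_epi a'.inv, comp_zero]
    apply Bounded.ι.map_injective
    rw [Functor.map_zero]
    exact hc.symm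
  have hX₃ : IsZero ((homologyFunctor Z (-2)).obj (t.Ψ M).obj) := by
    have := isIso_homology_mor₁ hT (-2) hB
    exact IsZero.of_epi_eq_zero ((homologyFunctor Z (-2)).map f)
      (by rw [hf, Functor.map_zero])
  refine (IsZero.iff_id_eq_zero M).2 (h₁ (𝟙 M) fun j hj => ?_)
  obtain hj | rfl | hj : j < -2 ∨ j = -2 ∨ -1 < j := by lia
  · exact isZero_of_isGE (t.Ψ M).obj (-2) j hj
  · exact hX₃
  · exact isZero_of_isLE (t.Ψ M).obj (-1) j hj

end Tilting

/-! ### Torsion pairs from noetherian objects. -/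

section Noetherian

variable {C : Type u} [Category.{v} C] [Abelian C]

/-- In an abelian category in which every object is noetherian, a class of objects that contains
zero and is closed under quotients and extensions is the torsion class of a torsion pair. -/
lemma isTorsionPair_rightOrthogonal (P : ObjectProperty C) [P.IsClosedUnderIsomorphisms]
    (h₀ : ∀ X, IsZero X → P X)
    (h₃ : ∀ S : ShortComplex C, S.ShortExact → P S.X₂ → P S.X₃)
    (h₂ : ∀ S : ShortComplex C, S.ShortExact → P S.X₁ → P S.X₃ → P S.X₂)
    (hC : ∀ X : C, IsNoetherianObject X) : IsTorsionPair P P.rightOrthogonal where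
  torsion_isClosedUnderIso := inferInstance
  torsionFree_isClosedUnderIso := inferInstance
  hom_eq_zero X Y f hX hY := hY f hX
  exists_shortExact E := by
    have := hC E
    -- The torsion part of `E` is a maximal subobject in `P`.
    obtain ⟨S, hS, hmax⟩ := WellFounded.has_min (r := (· > · : Subobject E → Subobject E → Prop))
      wellFounded_gt {S : Subobject E | P (S : C)}
      ⟨⊥, h₀ _ ((isZero_zero C).of_iso Subobject.botCoeIsoZero)⟩
    let p : E ⟶ cokernel S.arrow := cokernel.π S.arrow
    have hSE : (ShortComplex.mk S.arrow p (cokernel.condition _)).ShortExact :=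
      { exact := ShortComplex.exact_cokernel S.arrow }
    refine ⟨S, cokernel S.arrow, S.arrow, p, cokernel.condition _, hS, ?_, hSE⟩
    intro V f hV
    let W : C := Abelian.image f
    have hW : P W := by
      have hzero : kernel.ι f ≫ Abelian.factorThruImage f = 0 := by
        rw [← cancel_mono (Abelian.image.ι f)]
        simp
      refine h₃ (ShortComplex.mk (kernel.ι f) (Abelian.factorThruImage f) hzero) ?_ hV
      have hker := ShortComplex.exact_of_f_is_kernel
        (ShortComplex.mk (kernel.ι f) (Abelian.factorThruImage f) hzero)
        (KernelFork.IsLimit.ofι' (kernel.ι f) hzero fun k hk => ⟨kernel.lift f k (by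
          rw [← Abelian.image.fac f, ← Category.assoc, hk, zero_comp]), by simp⟩)
      exact { exact := hker }
    -- The preimage in `E` of the image of `f` extends that image by `S`, so it lies in `P`;
    -- maximality then forces the image to be zero.
    let W' : C := pullback p (Abelian.image.ι f)
    let j : (S : C) ⟶ W' := pullback.lift S.arrow (0 : (S : C) ⟶ W) (by simp [p])
    have hj₁ : j ≫ pullback.fst p (Abelian.image.ι f) = S.arrow := pullback.lift_fst _ _ _
    have hj₂ : j ≫ pullback.snd p (Abelian.image.ι f) = 0 := pullback.lift_snd _ _ _
    have hW' : P W' := by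
      refine h₂ (ShortComplex.mk j (pullback.snd p (Abelian.image.ι f)) hj₂) ?_ hS hW
      have : Mono j := mono_of_mono_fac hj₁
      suffices (ShortComplex.mk j (pullback.snd p (Abelian.image.ι f)) hj₂).Exact from
        { exact := this }
      refine ShortComplex.exact_of_f_is_kernel _
        (KernelFork.IsLimit.ofι' j _ fun {A} k hk => ⟨hSE.exact.lift
          (k ≫ pullback.fst p (Abelian.image.ι f)) ?_, ?_⟩)
      · dsimp
        rw [Category.assoc, pullback.condition, ← Category.assoc, hk, zero_comp]
      · apply pullback.hom_ext
        · rw [Category.assoc, hj₁]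
          exact hSE.exact.lift_f _ _
        · rw [Category.assoc, hj₂, comp_zero, hk]
    have hle : S ≤ Subobject.mk (pullback.fst p (Abelian.image.ι f)) :=
      Subobject.le_mk_of_comm j hj₁
    have heq : Subobject.mk (pullback.fst p (Abelian.image.ι f)) ≤ S := by
      by_contra hlt
      exact hmax (Subobject.mk (pullback.fst p (Abelian.image.ι f)))
        (P.prop_of_iso (Subobject.underlyingIso _).symm hW') (lt_of_le_not_ge hle hlt)
    have h₁ : pullback.fst p (Abelian.image.ι f) ≫ p = 0 := by
      rw [← Subobject.ofMkLE_arrow heq, Category.assoc, cokernel.condition, comp_zero]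
    have h₂ : Abelian.image.ι f = 0 := by
      rw [pullback.condition] at h₁
      rwa [← cancel_epi (pullback.snd p (Abelian.image.ι f)), comp_zero]
    rw [← Abelian.image.fac f, h₂, comp_zero]

/-- Finitely generated modules over a noetherian ring are noetherian objects. -/
lemma isNoetherianObject_FGModuleCat (R : Type v) [Ring R] [IsNoetherianRing R]
    (M : FGModuleCat.{v} R) : IsNoetherianObject M := by
  rw [isNoetherianObject_iff_monotone_chain_condition]
  intro f
  have inj (S : Subobject M) : Function.Injective S.arrow.hom.hom :=
    (ModuleCat.mono_iff_injective
      ((forget₂ (FGModuleCat.{v} R) (ModuleCat.{v} R)).map S.arrow)).1 inferInstance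
  let φ : Subobject M →o Submodule R M.obj :=
    { toFun S := LinearMap.range S.arrow.hom.hom
      monotone' S S' h := by
        rintro _ ⟨x, rfl⟩
        exact ⟨(Subobject.ofLE S S' h).hom.hom x,
          congr(($(Subobject.ofLE_arrow h)).hom.hom x)⟩ }
  -- Nested subobjects with the same range are equal, so chains of subobjects stabilize with their
  -- ranges.
  have hφ (S S' : Subobject M) (h : S ≤ S') (h' : φ S' ≤ φ S) : S = S' := by
    have : Epi (Subobject.ofLE S S' h) := by
      apply ConcreteCategory.epi_of_surjective
      intro y
      obtain ⟨x, hx⟩ := h' ⟨y, rfl⟩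
      exact ⟨x, inj S' (congr(($(Subobject.ofLE_arrow h)).hom.hom x).trans hx)⟩
    have := isIso_of_mono_of_epi (Subobject.ofLE S S' h)
    refine le_antisymm h (Subobject.le_of_comm (inv (Subobject.ofLE S S' h)) ?_)
    rw [IsIso.inv_comp_eq, Subobject.ofLE_arrow]
  obtain ⟨n, hn⟩ := monotone_stabilizes_iff_noetherian.2
    (inferInstance : IsNoetherian R M.obj) (φ.comp f)
  exact ⟨n, fun m hm => hφ _ _ (f.monotone hm) (hn m hm).ge⟩

end Noetherian

end TiltingHearts

end

open TiltingHearts in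
theorem corollary4 {Z : Type u} [Category.{v} Z] [Abelian Z] [HasDerivedCategory.{v} Z]
    (hnoeth : ∀ E : Z, IsNoetherianObject E)
    (hdim : TiltingHearts.HasHomologicalDimension Z 2)
    (T : Z) [IsNoetherianRing (End T)ᵐᵒᵖ]
    [HasDerivedCategory.{w₁} (TiltingHearts.RightMod T)]
    [HasDerivedCategory.{w₂} (ModuleCat.{v} (End T)ᵐᵒᵖ)]
    (t : TiltingHearts.Tilting.{w₁, w₂} T) :
    TiltingHearts.IsTorsionPair (t.C 0) (t.C 0).rightOrthogonal ∧
      (t.C 0).rightOrthogonal = (t.Y (-1)).rightOrthogonal ⊓ (t.Y (-2)).rightOrthogonal := by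
  have hC : IsTorsionPair (t.C 0) (t.C 0).rightOrthogonal :=
    isTorsionPair_rightOrthogonal (t.C 0)
      (fun X hX => (t.mem_C_zero_iff hdim X).2
        fun E f => (Functor.map_isZero _ hX).eq_of_src _ _)
      (fun S hS => t.C_zero_X₃ hdim hS) (fun S hS => t.C_zero_X₂ hdim hS)
      (isNoetherianObject_FGModuleCat _)
  -- `hV 0` says that `Y_{-1}` and `Y_{-2}` are contained in `C_0`.
  refine ⟨hC, le_antisymm (fun E hE => ⟨fun V f hV => hE f (hV 0 (by lia)),
    fun V f hV => hE f (hV 0 (by lia))⟩) fun E hE => ?_⟩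
  obtain ⟨X, Y, i, p, w, hX, hY, hS⟩ := hC.exists_shortExact E
  have := hS.mono_f
  have hX₀ : IsZero X := t.isZero_of_mem_C_zero hdim hX
    (fun V f hV => by
      rw [← cancel_mono i, zero_comp]
      exact hE.1 (f ≫ i) hV)
    (fun V f hV => by
      rw [← cancel_mono i, zero_comp]
      exact hE.2 (f ≫ i) hV)
  have : IsIso p := hS.isIso_g_iff.2 hX₀
  exact ObjectProperty.prop_of_iso _ (asIso p).symm hY
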